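/- Let $\kappa$ be a singular cardinal of uncountable cofinality, and let $(\kappa_i \mid i<\mathrm{cf}(\kappa))$ be a strictly increasing and continuous sequence of cardinals which is cofinal in $\kappa$ and such that $\kappa_0>\mathrm{cf}(\kappa)$. Suppose that $S\subset \mathrm{cf}(\kappa)$ is such that the following two conditions hold. (1) There is a sequence $(\tau_{i\alpha}\mid i\in S,\ \alpha<\mathrm{cf}(i))$ of infinite regular cardinals with $\tau_{i\alpha}<\kappa_i$ such that - for every $i\in S$ there is an ultrafilter $D_i$ on $\mathrm{cf}(i)$ which extends the Fréchet filter $\{X\subset\mathrm{cf}(i) : |\mathrm{cf}(i)\setminus X|<\mathrm{cf}(i)\}$, contains $\{\alpha<\mathrm{cf}(i) : \tau_{i\alpha}>\mathrm{cf}(\kappa)\}$, and satisfies $$\mathrm{cf}\Big(\prod_{\alpha<\mathrm{cf}(i)}\tau_{i\alpha}\Big/D_i\Big)=\kappa_i^{++};$$ - for every $j<\mathrm{cf}(\kappa)$, $$\big|\kappa_j\cap\{\tau_{i\alpha}\mid i\in S,\ \alpha<\mathrm{cf}(i)\}\big|<\mathrm{cf}(\kappa).$$ (2) If $i\in S$ is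 a limit point of $S$ (that is, $S\cap i\neq\emptyset$ and $i=\sup(S\cap i)$), then $$\max\big(\mathrm{pcf}(\{\kappa_j^{++}\mid j\in i\cap S\})\big)=\kappa_i^+ .$$ Here, for a set $A$ of cardinals, $\mathrm{pcf}(A)$ is the set of all cofinalities $\mathrm{cf}(\prod A/D)$, where $D$ is an ultrafilter on $A$ and the ultraproduct is ordered by the pointwise order modulo $D$. Then $S$ is not a stationary subset of $\mathrm{cf}(\kappa)$. -/

import Mathlib

open Cardinal Set

universe u

/-- The ultraproduct `∏ i, f i / D` of a family of cardinals `f i` (each identified with the set of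
ordinals below it) modulo an ultrafilter `D` on the index set. -/
def CardUltraproduct {ι : Type (u + 1)} (f : ι → Cardinal.{u}) (D : Ultrafilter ι) :
    Type (u + 1) :=
  (D : Filter ι).Product (fun i => Iio (f i).ord)

/-- The ultraproduct is ordered by `[g] ≤ [h]` iff `g i ≤ h i` for `D`-almost all `i`. -/
instance CardUltraproduct.instPreorder {ι : Type (u + 1)} (f : ι → Cardinal.{u})
    (D : Ultrafilter ι) : Preorder (CardUltraproduct f D) where
  le x y := Quotient.liftOn₂' x y (fun g h => ∀ᶠ i in (D : Filter ι), g i ≤ h i) (by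
    intro g h g' h' (hg : ∀ᶠ i in (D : Filter ι), g i = g' i)
      (hh : ∀ᶠ i in (D : Filter ι), h i = h' i)
    refine propext ⟨fun H => ?_, fun H => ?_⟩
    · filter_upwards [hg, hh, H] with i h1 h2 h3
      rwa [← h1, ← h2]
    · filter_upwards [hg, hh, H] with i h1 h2 h3
      rwa [h1, h2])
  le_refl x := by
    induction x using Quotient.inductionOn' with
    | h g => exact Filter.Eventually.of_forall (fun i => le_refl (g i))
  le_trans x y z := by
    induction x using Quotient.inductionOn' with
    | h g =>
      induction y using Quotient.inductionOn' with
      | h g' =>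
        induction z using Quotient.inductionOn' with
        | h g'' =>
          intro (h1 : ∀ᶠ i in (D : Filter ι), g i ≤ g' i)
            (h2 : ∀ᶠ i in (D : Filter ι), g' i ≤ g'' i)
          exact (h1.and h2).mono (fun i hi => le_trans hi.1 hi.2)

/-- `cf (∏ i, f i / D) = c`. The ultraproduct lives one universe above the cardinal `c`, hence the
`lift`. -/
def UltraproductCof {ι : Type (u + 1)} (f : ι → Cardinal.{u}) (D : Ultrafilter ι)
    (c : Cardinal.{u}) : Prop :=
  Order.cof (CardUltraproduct f D) = Cardinal.lift.{u + 1} c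

/-- The set `pcf A` of possible cofinalities of a (small) set `A` of cardinals: all cardinals of
the form `cf (∏ A / D)` where `D` is an ultrafilter on `A`. -/
def pcf (A : Set Cardinal.{u}) : Set Cardinal.{u} :=
  {c | ∃ D : Ultrafilter A, UltraproductCof (fun a : A => (a : Cardinal.{u})) D c}

/-- `D` extends the Fréchet filter on its index set `ι`: it contains every set whose complement has
smaller cardinality than `ι`. -/
def ExtendsFrechet {ι : Type (u + 1)} (D : Ultrafilter ι) : Prop :=
  ∀ X : Set ι, #(Xᶜ : Set ι) < #ι → X ∈ D

/-- `i` is a limit point of `S`, i.e. `i = sup (S ∩ i)` (and `S ∩ i` is non-empty). -/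
def IsLimitPointOf {α : Type*} [LinearOrder α] (S : Set α) (i : α) : Prop :=
  (S ∩ Iio i).Nonempty ∧ IsLUB (S ∩ Iio i) i

/-! Suppose S is stationary. For a limit i ∈ S, condition (2) yields a scale of length κ_i⁺ in ∏_{j
∈ S ∩ i} κ_j⁺⁺ modulo bounded sets (`exists_scale`). Hence there are χ ∈ ∏ κ_j⁺⁺, as large as
desired, that agree on a tail below each such i with one of κ_i⁺ functions u(i,δ) fixed in advance
(`exists_interleaved`).

Let f_i be a scale of length κ_i⁺⁺ in ∏_α τ_{iα} / D_i. Since κ_i⁺ < κ_i⁺⁺, a single w_i dominates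
modulo D_i all the values f_j(u(i,δ)(j))(β), compared at coordinates with τ_{jβ} = τ_{iα}. Let h
dominate the w_i in the same fiberwise sense, and choose χ so large that h(i,·) ≤ f_i(χ(i)) modulo
D_i. An equality τ_{iα} = τ_{jβ} > cf κ with j in the tail below i, w_i good at α and h good at β,
would give f_j(χ(j))(β) < w_i(α) < h(j,β) ≤ f_j(χ(j))(β). So each i has a good value τ_{iα} that is
not a good value for any j in a tail below i. By continuity τ_{iα} < κ_a for some a < i. Fodor's
lemma fixes a and produces cf κ distinct values below κ_a, against (1). -/

section Stationary

/-! ### Clubs, stationary sets and Fodor's lemma -/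

variable {α : Type u} [LinearOrder α]

theorem exists_isLUB_of_bddAbove [WellFoundedLT α] {s : Set α} (hs : BddAbove s) : ∃ x, IsLUB s x :=
  ⟨WellFounded.min wellFounded_lt _ hs, WellFounded.min_mem _ _ hs,
    fun _ hy => not_lt.1 fun h => WellFounded.not_lt_min wellFounded_lt _ hy h⟩

theorem exists_forall_lt_of_mk_lt_cof {J : Type u} (f : J → α) (h : #J < Order.cof α) :
    ∃ x, ∀ j, f j < x := by
  have : ¬ IsCofinal (range f) := fun hc => ((Order.cof_le hc).trans mk_range_le).not_gt h
  simpa [not_isCofinal_iff] using this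

theorem noMaxOrder_of_aleph0_lt_cof (hα : ℵ₀ < Order.cof α) : NoMaxOrder α := by
  refine ⟨fun a => ?_⟩
  obtain ⟨x, hx⟩ := exists_forall_lt_of_mk_lt_cof (fun _ : PUnit.{u + 1} => a)
    (by simpa using one_lt_aleph0.trans hα)
  exact ⟨x, hx default⟩

/-- The diagonal intersection of clubs is club. -/
theorem IsClub.diagonalInter [WellFoundedLT α] (hα : ℵ₀ < Order.cof α) (hα' : ∀ a : α, #(Iio a) < Order.cof α)
    {C : α → Set α} (hC : ∀ x, IsClub (C x)) : IsClub {i | ∀ x < i, i ∈ C x} := by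
  have := noMaxOrder_of_aleph0_lt_cof hα
  constructor
  · intro t ht _ _ a ha x hx
    obtain ⟨y, hy, hxy, -⟩ := ha.exists_between hx
    refine (hC x).isLUB_mem (t := {y ∈ t | x < y}) (fun z hz => ht hz.1 x hz.2) ⟨y, hy, hxy⟩ ?_
    refine ⟨fun z hz => ha.1 hz.1, fun b hb => ha.2 fun z hz => ?_⟩
    rcases lt_or_ge x z with h | h
    · exact hb ⟨hz, h⟩
    · exact h.trans (hxy.le.trans (hb ⟨hy, hxy⟩))
  · have key : ∀ a : α, ∃ e, a < e ∧ ∀ x ≤ a, e ∈ C x := by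
      intro a
      obtain ⟨b, hb⟩ := exists_gt a
      have hI : IsClub (⋂ x : Iio b, C x) := IsClub.iInter hα.ne' (by simpa using hα' b)
        fun x => hC x
      obtain ⟨e, he, hbe⟩ := hI.isCofinal b
      exact ⟨e, hb.trans_le hbe, fun x hx => mem_iInter.1 he ⟨x, hx.trans_lt hb⟩⟩
    choose e he heC using key
    intro a
    let s : ℕ → α := fun n => e^[n] a
    have hs : ∀ n, s (n + 1) = e (s n) := fun n => Function.iterate_succ_apply' _ _ _
    have hmono : StrictMono s := strictMono_nat_of_lt_succ fun n => by rw [hs]; exact he _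
    obtain ⟨b, hb⟩ : BddAbove (range s) := by
      obtain ⟨x, hx⟩ := exists_forall_lt_of_mk_lt_cof (fun n : ULift.{u} ℕ => s n.down)
        (by simpa using hα)
      exact ⟨x, by rintro _ ⟨n, rfl⟩; exact (hx ⟨n⟩).le⟩
    obtain ⟨l, hl⟩ := exists_isLUB_of_bddAbove ⟨b, hb⟩
    refine ⟨l, fun x hx => ?_, hl.1 ⟨0, rfl⟩⟩
    obtain ⟨_, ⟨n, rfl⟩, hxn, -⟩ := hl.exists_between hx
    -- Past the first `s n` above `x`, every later term lies in `C x` by the choice of `e`.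
    refine (hC x).isLUB_mem (t := range fun m => s (n + m + 1)) ?_ (range_nonempty _) ?_
    · rintro _ ⟨m, rfl⟩
      simp only [hs]
      exact heC _ _ (hxn.le.trans (hmono.monotone (by omega)))
    · refine ⟨?_, fun c hc => hl.2 ?_⟩
      · rintro _ ⟨m, rfl⟩
        exact hl.1 ⟨_, rfl⟩
      · rintro _ ⟨m, rfl⟩
        exact (hmono.monotone (by omega)).trans (hc ⟨m, rfl⟩)

/-- **Fodor's lemma**: a regressive function on a stationary set is constant on a stationary set. -/
theorem IsStationary.exists_isStationary_fiber [WellFoundedLT α]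
    (hα : ℵ₀ < Order.cof α)
    (hα' : ∀ a : α, #(Iio a) < Order.cof α) {S : Set α} (hS : IsStationary S) {r : α → α}
    (hr : ∀ i ∈ S, r i < i) : ∃ x, IsStationary {i ∈ S | r i = x} := by
  by_contra! h
  simp_rw [not_isStationary_iff] at h
  choose C hC hd using h
  obtain ⟨i, hi, hiD⟩ := hS (IsClub.diagonalInter hα hα' hC)
  exact disjoint_left.1 (hd (r i)) ⟨hi, rfl⟩ (hiD _ (hr i hi))

theorem IsUpperSet.isClub {s : Set α} (hs : IsUpperSet s) (hne : s.Nonempty) : IsClub s := by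
  refine ⟨fun t ht ⟨x, hx⟩ _ b hb => hs (hb.1 hx) (ht hx), fun x => ?_⟩
  obtain ⟨y, hy⟩ := hne
  exact ⟨max x y, hs (le_max_right _ _) hy, le_max_left _ _⟩

theorem IsStationary.exists_gt [NoMaxOrder α] {S : Set α} (hS : IsStationary S) (a : α) :
    ∃ i ∈ S, a < i :=
  hS ((isUpperSet_Ioi a).isClub nonempty_Ioi)

theorem IsStationary.inter_isSuccLimit [WellFoundedLT α] (hα : ℵ₀ < Order.cof α)
    (hα' : ∀ a : α, #(Iio a) < Order.cof α) {S : Set α} (hS : IsStationary S) :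
    IsStationary {i ∈ S | Order.IsSuccLimit i} := by
  have := noMaxOrder_of_aleph0_lt_cof hα
  obtain ⟨b, -⟩ := hS.nonempty
  -- The points of this diagonal intersection have no immediate predecessor.
  have hD := IsClub.diagonalInter hα hα' (C := fun x => {i | ∃ y, x < y ∧ y < i}) fun x =>
    IsUpperSet.isClub (fun i j hij ⟨y, hxy, hyi⟩ => ⟨y, hxy, hyi.trans_le hij⟩) (by
      obtain ⟨y, hy⟩ := NoMaxOrder.exists_gt x
      obtain ⟨z, hz⟩ := NoMaxOrder.exists_gt y
      exact ⟨z, y, hy, hz⟩)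
  intro t ht
  obtain ⟨i, hiS, ⟨hiD, hbi⟩, hit⟩ :=
    hS ((hD.inter hα.ne' ((isUpperSet_Ioi b).isClub nonempty_Ioi)).inter hα.ne' ht)
  refine ⟨i, ⟨hiS, not_isMin_iff.2 ⟨b, hbi⟩, fun x hx => ?_⟩, hit⟩
  obtain ⟨y, hxy, hyi⟩ := hiD x hx.lt
  exact hx.2 hxy hyi

/-- If `t i ∈ B i` has rank below `i` and avoids `B j` for all `j` in a final segment of `i`, then
the `t i` take as many values of bounded rank as there are elements of the order. -/
theorem IsStationary.exists_cof_le_mk [WellFoundedLT α] (hα : ℵ₀ < Order.cof α)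
    (hα' : ∀ a : α, #(Iio a) < Order.cof α) {S : Set α} (hS : IsStationary S) {β : Type u}
    (B : α → Set β) (R : α → Set β)
    (h : ∀ i ∈ S, ∃ a < i, ∃ x ∈ B i, x ∈ R a ∧ ∀ j ∈ S, a ≤ j → j < i → x ∉ B j) :
    ∃ a, Order.cof α ≤ #(R a) := by
  classical
  have := noMaxOrder_of_aleph0_lt_cof hα
  choose r hr x hxB hxR hx using fun i : S => h i i.2
  obtain ⟨a, ha⟩ := hS.exists_isStationary_fiber hα hα'
    (r := fun i => if h : i ∈ S then r ⟨i, h⟩ else i) fun i hi => by simpa [hi] using hr ⟨i, hi⟩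
  set U := {i ∈ S | (if h : i ∈ S then r ⟨i, h⟩ else i) = a} with hU
  have hra : ∀ i (hi : i ∈ U), r ⟨i, hi.1⟩ = a := fun i hi => by
    have := hi.2
    rwa [dif_pos hi.1] at this
  have hne : ∀ i (hi : i ∈ U) j (hj : j ∈ U), i < j → x ⟨i, hi.1⟩ ≠ x ⟨j, hj.1⟩ := by
    intro i hi j hj hij heq
    have hai : a ≤ i := (hra i hi).symm.trans_le (hr ⟨i, hi.1⟩).le
    exact hx ⟨j, hj.1⟩ i hi.1 ((hra j hj).trans_le hai) hij (heq ▸ hxB ⟨i, hi.1⟩)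
  have hcof : IsCofinal U := fun b => by
    obtain ⟨i, hi, hbi⟩ := ha.exists_gt b
    exact ⟨i, hi, hbi.le⟩
  refine ⟨a, (Order.cof_le hcof).trans (mk_le_of_injective
    (f := fun i : U => ⟨x ⟨i, i.2.1⟩, (congrArg R (hra i i.2)).subset (hxR ⟨i, i.2.1⟩)⟩) fun i j hij => ?_)⟩
  have hij : x ⟨i, i.2.1⟩ = x ⟨j, j.2.1⟩ := Subtype.mk.inj hij
  by_contra hn
  rcases lt_or_gt_of_ne (fun h => hn (Subtype.ext h)) with h | h
  · exact hne i i.2 j j.2 h hij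
  · exact hne j j.2 i i.2 h hij.symm

end Stationary

/-! ### Scales modulo a filter -/

section Scales

theorem exists_seq_of_bounded {L P : Type*} [LinearOrder L] [WellFoundedLT L] [Preorder P]
    (hP : ∀ (a : L) (f : Iio a → P), ∃ p, ∀ b, f b ≤ p) (Ψ : P → P) :
    ∃ ρ : L → P, ∀ a b, b < a → Ψ (ρ b) ≤ ρ a := by
  choose B hB using hP
  let ρ : L → P := WellFounded.fix (wellFounded_lt (α := L))
    fun a prev => B a fun b => Ψ (prev b b.2)
  refine ⟨ρ, fun a b hb => ?_⟩
  have : ρ a = B a fun b => Ψ (ρ b) := WellFounded.fix_eq _ _ _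
  rw [this]
  exact hB a (fun b => Ψ (ρ b)) ⟨b, hb⟩

variable {ι I L : Type u} {X : ι → Type u} [∀ i, LinearOrder (X i)]
  [LinearOrder I] [LinearOrder L]

theorem exists_pi_bound {J : Type u} (hX : ∀ i, #J < Order.cof (X i)) (f : J → ∀ i, X i) :
    ∃ g : ∀ i, X i, ∀ j i, f j i < g i := by
  choose g hg using fun i => exists_forall_lt_of_mk_lt_cof (fun j => f j i) (hX i)
  exact ⟨g, fun j i => hg i j⟩

theorem exists_monotone_mod [WellFoundedLT I] {l : Filter ι}
    (hdir : ∀ (ξ : I) (f : Iio ξ → ∀ i, X i), ∃ g : ∀ i, X i, ∀ η, ∀ᶠ i in l, f η i ≤ g i)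
    (F : I → ∀ i, X i) :
    ∃ F' : I → ∀ i, X i, F ≤ F' ∧ ∀ ξ η, ξ ≤ η → ∀ᶠ i in l, F' ξ i ≤ F' η i := by
  choose B hB using hdir
  let F' : I → ∀ i, X i := WellFounded.fix (wellFounded_lt (α := I))
    fun ξ prev => F ξ ⊔ B ξ fun η => prev η η.2
  have hF' : ∀ ξ, F' ξ = F ξ ⊔ B ξ fun η => F' η := fun ξ => WellFounded.fix_eq _ _ _
  refine ⟨F', fun ξ => by rw [hF']; exact le_sup_left, fun ξ η h => ?_⟩
  rcases h.eq_or_lt with rfl | h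
  · exact .of_forall fun _ => le_rfl
  filter_upwards [hB η (fun η => F' η) ⟨ξ, h⟩] with i hi
  rw [hF' η]
  exact hi.trans le_sup_right

/-- Passes from ultrafilters to the filter itself. If no scale exists, every increasing family is
strictly dominated modulo some ultrafilter `W`. Absorb a cofinal family for that `W` and repeat `L`
times: at a suitable column `ζ`, each stage crosses a fixed function `H` at some coordinate of `s`.
A coordinate is crossed only once, so `#L ≤ #s`. -/
theorem exists_scale [WellFoundedLT I] [WellFoundedLT L] [Nonempty I] [NoMaxOrder L] {l : Filter ι} {s : Set ι} (hs : s ∈ l)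
    (hsL : #s < #L) (hX : ∀ i, #L < Order.cof (X i)) (hI : #L < Order.cof I)
    (hdir : ∀ (ξ : I) (f : Iio ξ → ∀ i, X i), ∃ g : ∀ i, X i, ∀ η, ∀ᶠ i in l, f η i ≤ g i)
    (hcf : ∀ W : Ultrafilter ι, ↑W ≤ l →
      ∃ G : I → ∀ i, X i, ∀ g : ∀ i, X i, ∃ ξ, ∀ᶠ i in (W : Filter ι), g i ≤ G ξ i) :
    ∃ F : I → ∀ i, X i, (∀ ξ η, ξ ≤ η → ∀ᶠ i in l, F ξ i ≤ F η i) ∧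
      ∀ g : ∀ i, X i, ∃ ξ, ∀ᶠ i in l, g i ≤ F ξ i := by
  by_contra! hno
  have key : ∀ F : I → ∀ i, X i, (∀ ξ η, ξ ≤ η → ∀ᶠ i in l, F ξ i ≤ F η i) →
      ∃ (h : ∀ i, X i) (G : I → ∀ i, X i) (W : Ultrafilter ι), ↑W ≤ l ∧
        (∀ ξ, ∀ᶠ i in (W : Filter ι), F ξ i < h i) ∧
        ∀ g : ∀ i, X i, ∃ ξ, ∀ᶠ i in (W : Filter ι), g i ≤ G ξ i := by
    intro F hF
    obtain ⟨h, hh⟩ := hno F hF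
    have hne : (⨅ ξ, l ⊓ Filter.principal {i | F ξ i < h i}).NeBot := by
      refine Filter.iInf_neBot_of_directed' (fun ξ η => ⟨max ξ η, ?_, ?_⟩) fun ξ => ?_
      · refine le_inf inf_le_left ?_
        rw [Filter.le_principal_iff]
        filter_upwards [Filter.mem_inf_of_left (hF ξ _ (le_max_left ξ η)),
          Filter.mem_inf_of_right (Filter.mem_principal_self _)] with i h1 h2
        exact h1.trans_lt h2
      · refine le_inf inf_le_left ?_
        rw [Filter.le_principal_iff]
        filter_upwards [Filter.mem_inf_of_left (hF η _ (le_max_right ξ η)),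
          Filter.mem_inf_of_right (Filter.mem_principal_self _)] with i h1 h2
        exact h1.trans_lt h2
      · rw [← Filter.frequently_mem_iff_neBot]
        have := hh ξ
        simpa [Filter.not_eventually] using this
    obtain ⟨W, hW⟩ := Ultrafilter.exists_le (⨅ ξ, l ⊓ Filter.principal {i | F ξ i < h i})
    have hWl : (W : Filter ι) ≤ l :=
      (hW.trans (iInf_le _ (Classical.arbitrary I))).trans inf_le_left
    obtain ⟨G, hG⟩ := hcf W hWl
    exact ⟨h, G, W, hWl, fun ξ => (hW.trans (iInf_le _ ξ)) (Filter.mem_inf_of_right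
      (Filter.mem_principal_self _)), hG⟩
  choose inc hinc hmono using exists_monotone_mod hdir
  choose h G W hWl hlt hG using fun F => key (inc F) (hmono F)
  obtain ⟨ρ, hρ⟩ := exists_seq_of_bounded (L := L) (P := I → ∀ i, X i)
    (fun a f => by
      choose g hg using fun ξ : I => exists_pi_bound (J := Iio a)
        (fun i => (mk_set_le _).trans_lt (hX i)) (fun b => f b ξ)
      exact ⟨g, fun b ξ i => (hg ξ b i).le⟩)
    (fun F => inc F ⊔ G F)
  obtain ⟨H, hH⟩ := exists_pi_bound hX fun a => h (ρ a)
  choose ξ hξ using fun a => hG (ρ a) H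
  obtain ⟨ζ, hζ⟩ := exists_forall_lt_of_mk_lt_cof ξ hI
  -- At coordinate `i` the crossing of `H` occurs exactly between `a` and its successor `c`.
  have hinj : ∀ a : L, ∃ i ∈ s, inc (ρ a) ζ i < H i ∧ ∀ b, a < b → H i ≤ inc (ρ b) ζ i := by
    intro a
    obtain ⟨c, hc, hmin⟩ : ∃ c, a < c ∧ ∀ b, a < b → c ≤ b :=
      ⟨_, WellFounded.min_mem (wellFounded_lt (α := L)) (Ioi a) nonempty_Ioi,
        fun b hb => not_lt.1 fun h => WellFounded.not_lt_min wellFounded_lt _ hb h⟩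
    have hρc : inc (ρ a) ⊔ G (ρ a) ≤ ρ c := hρ c a hc
    have hsW : ∀ᶠ i in (W (ρ a) : Filter ι), i ∈ s := hWl (ρ a) hs
    obtain ⟨i, his, h1, h2, h3⟩ := (hsW.and
      ((hlt (ρ a) ζ).and ((hξ a).and (hWl (ρ a) (hmono (ρ c) _ _ (hζ a).le))))).exists
    refine ⟨i, his, h1.trans (hH a i), fun b hb => ?_⟩
    have h4 : H i ≤ inc (ρ c) ζ i :=
      (h2.trans ((le_sup_right.trans hρc) (ξ a) i)).trans ((hinc _ _ _).trans h3)
    refine h4.trans ?_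
    rcases (hmin b hb).eq_or_lt with rfl | hcb
    · exact le_rfl
    · exact ((le_sup_left.trans (hρ b c hcb)) ζ i).trans (hinc _ _ _)
  choose e hes he1 he2 using hinj
  refine hsL.not_ge (mk_le_of_injective (f := fun a => (⟨e a, hes a⟩ : s)) fun a b hab => ?_)
  have hab : e a = e b := congrArg Subtype.val hab
  by_contra hne
  rcases lt_or_gt_of_ne hne with hlt | hlt
  · exact (he1 b).not_ge (hab ▸ he2 a b hlt)
  · exact (he1 a).not_ge (hab ▸ he2 b a hlt)

/-- The function `u t δ` is a least upper bound modulo `l t` of the part of the scale below `δ`. A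
pointwise supremum `χ` of an `L`-sequence interleaved with all the scales at once is also such a
bound, and least upper bounds agree modulo `l t`. -/
theorem exists_interleaved [∀ i, WellFoundedLT (X i)] [WellFoundedLT L] [Nonempty L] [NoMaxOrder L]
    {T : Type u} {I : T → Type u} [∀ t, LinearOrder (I t)] [∀ t, WellFoundedLT (I t)]
    (hT : #T ≤ #L) (l : T → Filter ι) (hl : ∀ t, ∃ s ∈ l t, #s < Order.cof L)
    (hX : ∀ i, #L < Order.cof (X i)) (hI : ∀ t, #L < Order.cof (I t))
    (g : ∀ t, I t → ∀ i, X i) (hmono : ∀ t ξ η, ξ ≤ η → ∀ᶠ i in l t, g t ξ i ≤ g t η i)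
    (hcof : ∀ t (f : ∀ i, X i), ∃ ξ, ∀ᶠ i in l t, f i ≤ g t ξ i) :
    ∃ u : ∀ t, I t → ∀ i, X i, ∀ ρ₀ : ∀ i, X i, ∃ χ, ρ₀ ≤ χ ∧
      ∀ t, ∃ δ, ∀ᶠ i in l t, χ i = u t δ i := by
  classical
  let P (t : T) (δ : I t) (f : ∀ i, X i) : Prop :=
    (∀ ξ < δ, ∀ᶠ i in l t, g t ξ i ≤ f i) ∧
      ∀ f' : ∀ i, X i, (∀ ξ < δ, ∀ᶠ i in l t, g t ξ i ≤ f' i) → ∀ᶠ i in l t, f i ≤ f' i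
  let u (t : T) (δ : I t) : ∀ i, X i := if h : ∃ f, P t δ f then h.choose else g t δ
  refine ⟨u, fun ρ₀ => ?_⟩
  choose ξ hξ using hcof
  have hTX : ∀ i, #T < Order.cof (X i) := fun i => hT.trans_lt (hX i)
  choose B hB using fun f : ∀ i, X i => exists_pi_bound hTX fun t => g t (ξ t f)
  obtain ⟨ρ, hρ⟩ := exists_seq_of_bounded (L := L) (P := ∀ i, X i)
    (fun a f => by
      obtain ⟨g, hg⟩ := exists_pi_bound (J := Iio a)
        (fun i => (mk_set_le _).trans_lt (hX i)) f
      exact ⟨g, fun b i => (hg b i).le⟩)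
    (fun f => f ⊔ ρ₀ ⊔ B f)
  have hρmono : Monotone ρ := fun a b hab => by
    rcases hab.eq_or_lt with rfl | h
    · exact le_rfl
    · exact (le_sup_left.trans le_sup_left).trans (hρ b a h)
  choose χ hχ using fun i => exists_isLUB_of_bddAbove (s := range fun a => ρ a i) (by
    obtain ⟨x, hx⟩ := exists_forall_lt_of_mk_lt_cof (fun a => ρ a i) (hX i)
    exact ⟨x, by rintro _ ⟨a, rfl⟩; exact (hx a).le⟩)
  have hρχ : ∀ a i, ρ a i ≤ χ i := fun a i => (hχ i).1 ⟨a, rfl⟩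
  refine ⟨χ, fun i => ?_, fun t => ?_⟩
  · obtain ⟨a⟩ := ‹Nonempty L›
    obtain ⟨b, hb⟩ := exists_gt a
    exact ((le_sup_right.trans le_sup_left).trans (hρ b a hb) i).trans (hρχ b i)
  have hbdd := exists_forall_lt_of_mk_lt_cof (fun a => ξ t (ρ a)) (hI t)
  let δ := WellFounded.min (wellFounded_lt (α := I t)) {x | ∀ a, ξ t (ρ a) < x} hbdd
  have hδ : ∀ a, ξ t (ρ a) < δ := WellFounded.min_mem _ _ hbdd
  have hδ' : ∀ η < δ, ∃ a, η ≤ ξ t (ρ a) := fun η hη => by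
    by_contra! hc
    exact WellFounded.not_lt_min wellFounded_lt (s := {x | ∀ a, ξ t (ρ a) < x}) hc hη
  have hP : P t δ χ := by
    refine ⟨fun η hη => ?_, fun f' hf' => ?_⟩
    · obtain ⟨a, ha⟩ := hδ' η hη
      obtain ⟨b, hb⟩ := exists_gt a
      filter_upwards [hmono t _ _ ha] with i hi
      exact hi.trans ((hB (ρ a) t i).le.trans ((le_sup_right.trans (hρ b a hb) i).trans (hρχ b i)))
    · obtain ⟨s, hs, hsL⟩ := hl t
      -- If `f' i < χ i`, some stage already exceeds `f' i`; as `#s < Order.cof L`, one stage serves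
      -- all of `s`.
      have hex : ∀ i : s, ∃ a, f' i < χ i → f' i < ρ a i := by
        intro i
        by_cases h : f' i < χ i
        · obtain ⟨_, ⟨a, rfl⟩, ha⟩ := (lt_isLUB_iff (hχ i)).1 h
          exact ⟨a, fun _ => ha⟩
        · exact ⟨Classical.arbitrary L, fun h' => absurd h' h⟩
      choose A hA using hex
      obtain ⟨a, ha⟩ := exists_forall_lt_of_mk_lt_cof A hsL
      filter_upwards [hs, hξ t (ρ a), hf' _ (hδ a)] with i his h1 h2
      by_contra! h3
      exact ((hA ⟨i, his⟩ h3).trans_le (hρmono (ha ⟨i, his⟩).le i)).not_ge (h1.trans h2)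
  refine ⟨δ, ?_⟩
  have hex : ∃ f, P t δ f := ⟨χ, hP⟩
  have hu : u t δ = hex.choose := dif_pos hex
  rw [hu]
  filter_upwards [hP.2 _ hex.choose_spec.1, hex.choose_spec.2 _ hP.1] with i h1 h2
  exact le_antisymm h1 h2

end Scales

/-! ### Cofinality and size of initial ordinals -/

section Ordinals

theorem Cardinal.IsRegular.orderCof_Iio_ord {c : Cardinal.{u}} (hc : c.IsRegular) :
    Order.cof (Iio c.ord) = Cardinal.lift.{u + 1} c := by
  rw [Ordinal.cof_Iio, ← Ordinal.lift_cof, hc.cof_ord]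

theorem mk_Iio_ord (c : Cardinal.{u}) : #(Iio c.ord) = Cardinal.lift.{u + 1} c := by
  rw [mk_Iio_ordinal, card_ord]

theorem mk_Iio_lt_lift {c : Cardinal.{u}} (x : Iio c.ord) :
    #(Iio x) < Cardinal.lift.{u + 1} c := by
  have h : #(Iio x) ≤ #(Iio (x : Ordinal.{u})) :=
    mk_le_of_injective (f := fun y => ⟨y.1.1, y.2⟩) fun a b hab =>
      Subtype.ext (Subtype.ext (Subtype.mk.inj hab))
  refine h.trans_lt ?_
  rw [mk_Iio_ordinal, lift_lt]
  exact lt_ord.1 x.2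

end Ordinals

/-! ### Cofinal families in ultraproducts -/

section Ultraproduct

variable {ι : Type (u + 1)} {f : ι → Cardinal.{u}} {D : Ultrafilter ι}

/-- The class of a function in the ultraproduct. -/
def CardUltraproduct.mk (f : ι → Cardinal.{u}) (D : Ultrafilter ι) (g : ∀ i, Iio (f i).ord) :
    CardUltraproduct f D :=
  Quotient.mk'' g

theorem CardUltraproduct.mk_surjective : Function.Surjective (CardUltraproduct.mk f D) :=
  Quotient.mk''_surjective

theorem CardUltraproduct.mk_le_mk {g h : ∀ i, Iio (f i).ord} :
    CardUltraproduct.mk f D g ≤ CardUltraproduct.mk f D h ↔ ∀ᶠ i in (D : Filter ι), g i ≤ h i :=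
  Iff.rfl

theorem CardUltraproduct.exists_cofinal [Nonempty (∀ i, Iio (f i).ord)] {c : Cardinal.{u}}
    (h : Order.cof (CardUltraproduct f D) ≤ Cardinal.lift.{u + 1} c) :
    ∃ G : Iio c.ord → ∀ i, Iio (f i).ord,
      ∀ g : ∀ i, Iio (f i).ord, ∃ ξ, ∀ᶠ i in (D : Filter ι), g i ≤ G ξ i := by
  obtain ⟨s, hs, hsc⟩ := Order.exists_cof_eq (CardUltraproduct f D)
  rw [← hsc, ← mk_Iio_ord] at h
  obtain ⟨e⟩ := h
  have hex : ∀ ξ, ∃ g : ∀ i, Iio (f i).ord, ∀ x : s, e x = ξ →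
      CardUltraproduct.mk f D g = x := by
    intro ξ
    by_cases hξ : ∃ x, e x = ξ
    · obtain ⟨x, rfl⟩ := hξ
      obtain ⟨g, hg⟩ := CardUltraproduct.mk_surjective x.1
      exact ⟨g, fun y hy => by rw [e.injective hy]; exact hg⟩
    · exact ⟨Classical.arbitrary _, fun x hx => absurd ⟨x, hx⟩ hξ⟩
  choose G hG using hex
  refine ⟨G, fun g => ?_⟩
  obtain ⟨y, hy, hgy⟩ := hs (CardUltraproduct.mk f D g)
  exact ⟨e ⟨y, hy⟩, CardUltraproduct.mk_le_mk.1 (hgy.trans_eq (hG _ ⟨y, hy⟩ rfl).symm)⟩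

theorem CardUltraproduct.exists_eventually_lt {J : Type (u + 1)}
    (hJ : #J < Order.cof (CardUltraproduct f D)) (H : J → ∀ i, Iio (f i).ord) :
    ∃ w : ∀ i, Iio (f i).ord, ∀ j, ∀ᶠ i in (D : Filter ι), H j i < w i := by
  have hnc : ¬ IsCofinal (range fun j => CardUltraproduct.mk f D (H j)) :=
    fun hc => ((Order.cof_le hc).trans mk_range_le).not_gt hJ
  simp only [IsCofinal, not_forall] at hnc
  obtain ⟨x, hx⟩ := hnc
  obtain ⟨w, rfl⟩ := CardUltraproduct.mk_surjective x
  refine ⟨w, fun j => ?_⟩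
  have : ¬ ∀ᶠ i in (D : Filter ι), w i ≤ H j i := fun h => hx ⟨_, ⟨j, rfl⟩, h⟩
  rw [← Ultrafilter.eventually_not] at this
  simpa using this

theorem UltraproductCof.exists_scale [Nonempty (∀ i, Iio (f i).ord)] {c : Cardinal.{u}}
    (h : UltraproductCof f D c) :
    ∃ F : Iio c.ord → ∀ i, Iio (f i).ord,
      (∀ ξ η, ξ ≤ η → ∀ᶠ i in (D : Filter ι), F ξ i ≤ F η i) ∧
        ∀ g : ∀ i, Iio (f i).ord, ∃ ξ, ∀ᶠ i in (D : Filter ι), g i ≤ F ξ i := by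
  obtain ⟨G, hG⟩ := CardUltraproduct.exists_cofinal (h : _ = _).le
  obtain ⟨F, hGF, hF⟩ := exists_monotone_mod (l := (D : Filter ι)) (fun ξ f' => by
    obtain ⟨w, hw⟩ := CardUltraproduct.exists_eventually_lt (D := D)
      ((mk_Iio_lt_lift ξ).trans_eq (h : _ = _).symm) f'
    exact ⟨w, fun η => (hw η).mono fun i hi => hi.le⟩) G
  refine ⟨F, hF, fun g => ?_⟩
  obtain ⟨ξ, hξ⟩ := hG g
  exact ⟨ξ, hξ.mono fun i hi => hi.trans (hGF ξ i)⟩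

/-- Smallness of `A` makes the cofinality a lift from the lower universe, hence a member of `pcf A`.
-/
theorem orderCof_cardUltraproduct_le {A : Set Cardinal.{u}} [Small.{u} A] {c : Cardinal.{u}}
    (hc : c ∈ upperBounds (pcf A)) (D : Ultrafilter A) :
    Order.cof (CardUltraproduct (fun a : A => (a : Cardinal.{u})) D) ≤
      Cardinal.lift.{u + 1} c := by
  have h1 : Order.cof (CardUltraproduct (fun a : A => (a : Cardinal.{u})) D) ≤
      Cardinal.lift.{u + 1} #(Shrink.{u} (∀ a : A, Iio (a : Cardinal.{u}).ord)) := by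
    refine (Order.cof_le_cardinalMk _).trans ?_
    refine (mk_le_of_surjective CardUltraproduct.mk_surjective).trans_eq ?_
    simp
  obtain ⟨d, hd⟩ := Cardinal.mem_range_lift_of_le h1
  rw [← hd, lift_le]
  exact hc ⟨D, hd.symm⟩

end Ultraproduct

/-! ### The filter of tails below a point -/

section Tails

/-- The filter on `α` generated by the sets `{j ∈ S | a ≤ j < i}`, `a < i`. -/
def tailFilter {α : Type*} [LinearOrder α] (S : Set α) (i : α) : Filter α :=
  Filter.map (Subtype.val : Iio i → α) Filter.atTop ⊓ Filter.principal S

theorem eventually_tailFilter {α : Type*} [LinearOrder α] {S : Set α} {i : α}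
    (hi : (Iio i).Nonempty) {p : α → Prop} :
    (∀ᶠ j in tailFilter S i, p j) ↔ ∃ a < i, ∀ j ∈ S, a ≤ j → j < i → p j := by
  have : Nonempty (Iio i) := hi.to_subtype
  rw [tailFilter, Filter.eventually_inf_principal, Filter.eventually_map, Filter.eventually_atTop]
  constructor
  · rintro ⟨a, ha⟩
    exact ⟨a, a.2, fun j hj haj hji => ha ⟨j, hji⟩ haj hj⟩
  · rintro ⟨a, hai, ha⟩
    exact ⟨⟨a, hai⟩, fun j haj hj => ha j hj haj j.2⟩

end Tails

/-! ### The pcf argument -/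

section Main

variable {c : Cardinal.{u}} {k : Iio c.ord → Cardinal.{u}} {S : Set (Iio c.ord)}

theorem isRegular_succ_succ {d : Cardinal.{u}} (hd : ℵ₀ ≤ d) :
    (Order.succ (Order.succ d)).IsRegular :=
  isRegular_succ (hd.trans (Order.le_succ d))

/-- Enumerate the functions in type at most κ_i. At `j` only those with index below κ_j are bounded,
which κ_j⁺⁺ permits; by continuity each function is eventually included. -/
theorem exists_tail_bound (hk : Order.IsNormal k) (hk0 : ∀ j, ℵ₀ ≤ k j) {i : Iio c.ord}
    (hi : Order.IsSuccLimit i) {J : Type (u + 1)} (hJ : #J ≤ Cardinal.lift.{u + 1} (k i))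
    (f : J → ∀ j, Iio (Order.succ (Order.succ (k j))).ord) :
    ∃ g : ∀ j, Iio (Order.succ (Order.succ (k j))).ord,
      ∀ q, ∀ᶠ j in tailFilter S i, f q j ≤ g j := by
  rw [← mk_Iio_ord] at hJ
  obtain ⟨e⟩ := hJ
  have hex : ∀ j, ∃ x : Iio (Order.succ (Order.succ (k j))).ord,
      ∀ q : {q : J // (e q : Ordinal.{u}) < (k j).ord}, f q j < x := by
    intro j
    refine exists_forall_lt_of_mk_lt_cof _ ?_
    have h1 : #{q : J // (e q : Ordinal.{u}) < (k j).ord} ≤ #(Iio (k j).ord) :=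
      mk_le_of_injective (f := fun q => ⟨e q.1, q.2⟩) fun a b hab =>
        Subtype.ext (e.injective (Subtype.ext (Subtype.mk.inj hab)))
    rw [(isRegular_succ_succ (hk0 j)).orderCof_Iio_ord]
    refine h1.trans_lt ?_
    rw [mk_Iio_ord, lift_lt]
    exact (Order.lt_succ _).trans (Order.lt_succ _)
  choose g hg using hex
  refine ⟨g, fun q => ?_⟩
  obtain ⟨a, hai, ha⟩ := (hk.lt_iff_exists_lt hi).1 (lt_ord.1 (e q).2)
  refine (eventually_tailFilter ⟨a, hai⟩).2 ⟨a, hai, fun j _ haj _ => (hg j ⟨q, ?_⟩).le⟩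
  exact lt_ord.2 (ha.trans_le (hk.monotone haj))

theorem exists_scale_tailFilter (hc : c.IsRegular) (hc0 : ℵ₀ < c)
    (hk : Order.IsNormal k) (hck : ∀ j, c < k j) {i : Iio c.ord}
    (hi : Order.IsSuccLimit i)
    (h2 : IsLimitPointOf S i → Order.succ (k i) ∈ upperBounds
      (pcf {d : Cardinal.{u} | ∃ j ∈ S, j < i ∧ d = Order.succ (Order.succ (k j))})) :
    ∃ F : Iio (Order.succ (k i)).ord → ∀ j, Iio (Order.succ (Order.succ (k j))).ord,
      (∀ ξ η, ξ ≤ η → ∀ᶠ j in tailFilter S i, F ξ j ≤ F η j) ∧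
        ∀ g : ∀ j, Iio (Order.succ (Order.succ (k j))).ord,
          ∃ ξ, ∀ᶠ j in tailFilter S i, g j ≤ F ξ j := by
  have hk0 : ∀ j, ℵ₀ ≤ k j := fun j => (hc0.trans (hck j)).le
  have hreg := isRegular_succ (hk0 i)
  have hIi : (Iio i).Nonempty := not_isMin_iff.1 hi.not_isMin
  have hI : Nonempty (Iio (Order.succ (k i)).ord) := ⟨⟨0, hreg.ord_pos⟩⟩
  have hX : ∀ j, Nonempty (Iio (Order.succ (Order.succ (k j))).ord) :=
    fun j => ⟨⟨0, (isRegular_succ_succ (hk0 j)).ord_pos⟩⟩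
  -- If `S` is bounded below `i`, the tail filter is trivial and any family works.
  by_cases hlim : ∃ a < i, ∀ j ∈ S, a ≤ j → ¬ j < i
  · obtain ⟨a, hai, ha⟩ := hlim
    have hev : ∀ p : Iio c.ord → Prop, ∀ᶠ j in tailFilter S i, p j := fun p =>
      (eventually_tailFilter hIi).2 ⟨a, hai, fun j hj haj hji => absurd hji (ha j hj haj)⟩
    exact ⟨fun _ _ => Classical.arbitrary _, fun _ _ _ => hev _, fun _ => ⟨hI.some, hev _⟩⟩
  push Not at hlim
  have hpt : IsLimitPointOf S i := by
    refine ⟨?_, fun j hj => hj.2.le, fun b hb => ?_⟩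
    · obtain ⟨a, ha⟩ := hIi
      obtain ⟨j, hj, -, hji⟩ := hlim a ha
      exact ⟨j, hj, hji⟩
    · by_contra! hbi
      obtain ⟨b', hbb', hb'⟩ := (not_covBy_iff hbi).1 (hi.isSuccPrelimit b)
      obtain ⟨j, hj, hbj, hji⟩ := hlim b' hb'
      exact (hbb'.trans_le hbj).not_ge (hb ⟨hj, hji⟩)
  have hLX : ∀ j, #(Iio c.ord) < Order.cof (Iio (Order.succ (Order.succ (k j))).ord) := fun j => by
    rw [(isRegular_succ_succ (hk0 j)).orderCof_Iio_ord, mk_Iio_ord, lift_lt]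
    exact (hck j).trans ((Order.lt_succ _).trans (Order.lt_succ _))
  have hLI : #(Iio c.ord) < Order.cof (Iio (Order.succ (k i)).ord) := by
    rw [hreg.orderCof_Iio_ord, mk_Iio_ord, lift_lt]
    exact (hck i).trans (Order.lt_succ _)
  have hmax : NoMaxOrder (Iio c.ord) :=
    noMaxOrder_of_aleph0_lt_cof (by rw [hc.orderCof_Iio_ord]; simpa using hc0)
  refine exists_scale (L := Iio c.ord) (s := Iio i) ?_ ?_ hLX hLI ?_ ?_
  · obtain ⟨a, ha⟩ := hIi
    exact (eventually_tailFilter ⟨a, ha⟩).2 ⟨a, ha, fun j _ _ hj => hj⟩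
  · rw [mk_Iio_ord]
    exact mk_Iio_lt_lift i
  · intro ξ f
    refine exists_tail_bound hk hk0 hi ?_ f
    have := mk_Iio_lt_lift ξ
    rwa [lift_succ, Order.lt_succ_iff] at this
  · intro W hW
    classical
    set A : Set Cardinal.{u} := {d | ∃ j ∈ S, j < i ∧ d = Order.succ (Order.succ (k j))} with hA
    obtain ⟨j₀, hj₀, hj₀i⟩ := hpt.1
    have : Small.{u} A := by
      refine small_subset (s := range fun j => Order.succ (Order.succ (k j))) ?_
      rintro _ ⟨j, -, -, rfl⟩
      exact ⟨j, rfl⟩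
    let e : Iio c.ord → A := fun j =>
      if h : j ∈ S ∧ j < i then ⟨Order.succ (Order.succ (k j)), j, h.1, h.2, rfl⟩
      else ⟨Order.succ (Order.succ (k j₀)), j₀, hj₀, hj₀i, rfl⟩
    have he : ∀ j, j ∈ S → j < i → (e j : Cardinal.{u}) = Order.succ (Order.succ (k j)) := by
      intro j h1 h2
      simp [e, h1, h2]
    have hAne : Nonempty (∀ a : A, Iio (a : Cardinal.{u}).ord) := by
      refine ⟨fun a => ⟨0, ?_⟩⟩
      obtain ⟨j, -, -, hj⟩ := a.2
      rw [hj]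
      exact (isRegular_succ_succ (hk0 j)).ord_pos
    obtain ⟨G, hG⟩ := CardUltraproduct.exists_cofinal
      (orderCof_cardUltraproduct_le (h2 hpt) (W.map e))
    have hWS : ∀ᶠ j in (W : Filter (Iio c.ord)), j ∈ S ∧ j < i := by
      refine hW ((eventually_tailFilter hIi).2 ⟨j₀, hj₀i, fun j hj _ hji => ⟨hj, hji⟩⟩)
    refine ⟨fun ξ j => if h : j ∈ S ∧ j < i then ⟨G ξ (e j), he j h.1 h.2 ▸ (G ξ (e j)).2⟩
      else Classical.arbitrary _, fun g => ?_⟩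
    choose s hsS hsi hs using fun a : A => a.2
    obtain ⟨ξ, hξ⟩ := hG fun a => ⟨g (s a), by rw [hs a]; exact (g (s a)).2⟩
    rw [Ultrafilter.coe_map, Filter.eventually_map] at hξ
    refine ⟨ξ, ?_⟩
    filter_upwards [hξ, hWS] with j hj hjS
    have hse : s (e j) = j := by
      have h := (hs (e j)).symm.trans (he j hjS.1 hjS.2)
      exact hk.strictMono.injective (Order.succ_injective (Order.succ_injective h))
    rw [dif_pos hjS]
    have hg : (g (s (e j)) : Ordinal.{u}) = g j := by rw [hse]
    rw [← Subtype.coe_le_coe] at hj ⊢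
    exact hg.symm.trans_le hj

/-- A fiber of `τ` has at most `c` indices, fewer than the regular cardinal `τ p` when `c < τ p`. -/
theorem exists_fiber_bound {J : Type (u + 1)} {τ : J → Cardinal.{u}}
    (hJ : #J ≤ Cardinal.lift.{u + 1} c) (hτ : ∀ p, (τ p).IsRegular)
    (v : ∀ p, Iio (τ p).ord) :
    ∃ H : ∀ p, Iio (τ p).ord, ∀ p q, τ p = τ q → c < τ p → (v q : Ordinal.{u}) < H p := by
  have hex : ∀ p, ∃ x : Iio (τ p).ord, ∀ q, τ p = τ q → c < τ p → (v q : Ordinal.{u}) < x := by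
    intro p
    by_cases hp : c < τ p
    · obtain ⟨x, hx⟩ := exists_forall_lt_of_mk_lt_cof (α := Iio (τ p).ord)
        (fun q : {q // τ p = τ q} => ⟨v q, (v q).2.trans_eq (congrArg ord q.2.symm)⟩) (by
          rw [(hτ p).orderCof_Iio_ord]
          exact ((mk_subtype_le _).trans hJ).trans_lt (by simpa using hp))
      exact ⟨x, fun q hq _ => hx ⟨q, hq⟩⟩
    · exact ⟨v p, fun q _ h => absurd h hp⟩
  choose H hH using hex
  exact ⟨H, hH⟩

theorem not_isStationary_of_pcf (hc : c.IsRegular) (hc0 : ℵ₀ < c)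
    (hk_normal : Order.IsNormal k) (hck : ∀ j, c < k j)
    (h1 : ∃ τ : (i : Iio c.ord) → Iio (i : Ordinal.{u}).cof.ord → Cardinal.{u},
      (∀ i ∈ S, ∀ α, (τ i α).IsRegular ∧ τ i α < k i) ∧
      (∀ i ∈ S, ∃ D : Ultrafilter (Iio (i : Ordinal.{u}).cof.ord),
        ExtendsFrechet D ∧ (∀ᶠ α in (D : Filter _), c < τ i α) ∧
        UltraproductCof (τ i) D (Order.succ (Order.succ (k i)))) ∧
      (∀ j : Iio c.ord,
        #{c : Cardinal.{u} | c < k j ∧ ∃ i ∈ S, ∃ α, c = τ i α} <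
          Cardinal.lift.{u + 1} c))
    (h2 : ∀ i ∈ S, IsLimitPointOf S i →
      IsGreatest (pcf {c : Cardinal.{u} | ∃ j ∈ S, j < i ∧ c = Order.succ (Order.succ (k j))})
        (Order.succ (k i))) :
    ¬ IsStationary S := by
  intro hS
  obtain ⟨τ, hτ, hD, hsmall⟩ := h1
  have hcof : ℵ₀ < Order.cof (Iio c.ord) := by
    rw [hc.orderCof_Iio_ord]; simpa using hc0
  have hIio : ∀ a : Iio c.ord, #(Iio a) < Order.cof (Iio c.ord) := fun a => by
    rw [hc.orderCof_Iio_ord]; exact mk_Iio_lt_lift a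
  have hmax := noMaxOrder_of_aleph0_lt_cof hcof
  have hk0 : ∀ j, ℵ₀ ≤ k j := fun j => (hc0.trans (hck j)).le
  let S' := {i ∈ S | Order.IsSuccLimit i}
  have hS' : IsStationary S' := hS.inter_isSuccLimit hcof hIio
  choose F hFmono hFcof using fun i : S' => exists_scale_tailFilter (S := S) hc hc0 hk_normal hck
    i.2.2 fun hi => (h2 i i.2.1 hi).2
  have hX : ∀ j, #(Iio c.ord) < Order.cof (Iio (Order.succ (Order.succ (k j))).ord) := fun j => by
    rw [(isRegular_succ_succ (hk0 j)).orderCof_Iio_ord, mk_Iio_ord, lift_lt]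
    exact (hck j).trans ((Order.lt_succ _).trans (Order.lt_succ _))
  have hne : Nonempty (Iio c.ord) := ⟨⟨0, hc.ord_pos⟩⟩
  obtain ⟨u, hu⟩ := exists_interleaved (L := Iio c.ord) (mk_set_le S')
    (fun i => tailFilter S i) (fun i => ⟨Iio i, by
      obtain ⟨a, ha⟩ := not_isMin_iff.1 i.2.2.not_isMin
      exact (eventually_tailFilter ⟨a, ha⟩).2 ⟨a, ha, fun j _ _ hj => hj⟩, hIio i⟩) hX
    (fun i => by
      rw [(isRegular_succ (hk0 i)).orderCof_Iio_ord, mk_Iio_ord, lift_lt]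
      exact (hck i).trans (Order.lt_succ _)) F hFmono hFcof
  choose D hDτ hDcof using fun i : S' => (hD i i.2.1).imp fun _ h => h.2
  have hτne : ∀ i : S', Nonempty (∀ α, Iio (τ i α).ord) := fun i =>
    ⟨fun α => ⟨0, (hτ i i.2.1 α).1.ord_pos⟩⟩
  choose f hfmono hfcof using fun i : S' => (hDcof i).exists_scale
  let J := Σ i : S', Iio (i.1.1 : Ordinal.{u}).cof.ord
  have hJ : #J ≤ Cardinal.lift.{u + 1} c := by
    have h : #J ≤ #(Iio c.ord × Iio c.ord) := by
      refine mk_le_of_injective (f := fun p => (p.1.1, ⟨p.2.1, ?_⟩)) ?_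
      · exact (p.2.2.trans_le (Ordinal.ord_cof_le _)).trans p.1.1.2
      · rintro ⟨i, α⟩ ⟨j, β⟩ h
        obtain ⟨h1, h2⟩ := Prod.mk.inj h
        obtain rfl : i = j := Subtype.ext h1
        obtain rfl : α = β := Subtype.ext (Subtype.mk.inj h2)
        rfl
    rw [← mul_def, mk_Iio_ord, mul_eq_self (by simpa using hc0.le)] at h
    exact h
  let T : J → Cardinal.{u} := fun p => τ p.1 p.2
  have hT : ∀ p, (T p).IsRegular := fun p => (hτ p.1 p.1.2.1 p.2).1
  choose H hH using fun (i : S') (δ : Iio (Order.succ (k i)).ord) =>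
    exists_fiber_bound hJ hT fun p => f p.1 (u i δ p.1) p.2
  choose w hw using fun i : S' => CardUltraproduct.exists_eventually_lt (D := D i)
    (J := Iio (Order.succ (k i)).ord) (by
      rw [show Order.cof _ = _ from hDcof i, mk_Iio_ord, lift_lt]
      exact Order.lt_succ _) fun δ α => H i δ ⟨i, α⟩
  obtain ⟨h, hh⟩ := exists_fiber_bound hJ hT fun p => w p.1 p.2
  choose ρ hρ using fun i : S' => hfcof i fun α => h ⟨i, α⟩
  classical
  -- `χ` is chosen last: `ρ` depends on `u`, but `u` was fixed before any lower bound for `χ`.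
  obtain ⟨χ, hρχ, hχ⟩ := hu fun j => if hj : j ∈ S' then ρ ⟨j, hj⟩ else
    ⟨0, (isRegular_succ_succ (hk0 j)).ord_pos⟩
  have hρχ' : ∀ i : S', ρ i ≤ χ i := fun i => by
    exact (dif_pos i.2).symm.trans_le (hρχ i)
  obtain ⟨a, ha⟩ := hS'.exists_cof_le_mk hcof hIio
    (fun i => {t | ∃ (hi : i ∈ S') (α : _), c < τ i α ∧ h ⟨⟨i, hi⟩, α⟩ ≤ f ⟨i, hi⟩ (χ i) α ∧
      t = τ i α})
    (fun a => {d | d < k a ∧ ∃ i ∈ S, ∃ α, d = τ i α}) (by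
      intro i hi
      obtain ⟨δ, hδ⟩ := hχ ⟨i, hi⟩
      obtain ⟨b, hbi, hb⟩ := (eventually_tailFilter (not_isMin_iff.1 hi.2.not_isMin)).1 hδ
      obtain ⟨α, h1, h2, h3, h4⟩ := ((hDτ ⟨i, hi⟩).and ((hρ ⟨i, hi⟩).and
        ((hfmono ⟨i, hi⟩ _ _ (hρχ' ⟨i, hi⟩)).and (hw ⟨i, hi⟩ δ)))).exists
      obtain ⟨b', hb'i, hb'⟩ := (hk_normal.lt_iff_exists_lt hi.2).1 (hτ i hi.1 α).2
      refine ⟨max b b', max_lt hbi hb'i, τ i α, ⟨hi, α, h1, h2.trans h3, rfl⟩,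
        ⟨hb'.trans_le (hk_normal.monotone (le_max_right _ _)), i, hi.1, α, rfl⟩, ?_⟩
      rintro j hj hbj hji ⟨_, β, hβ, hle, heq⟩
      -- On the tail `χ j = u i δ j`, so `f j (χ j) β < H < w < h ≤ f j (χ j) β`, a contradiction.
      have e1 := hb j hj.1 ((le_max_left _ _).trans hbj) hji
      have l1 : (f ⟨j, hj⟩ (u ⟨i, hi⟩ δ j) β : Ordinal.{u}) < H ⟨i, hi⟩ δ ⟨⟨i, hi⟩, α⟩ :=
        hH ⟨i, hi⟩ δ ⟨⟨i, hi⟩, α⟩ ⟨⟨j, hj⟩, β⟩ heq h1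
      have l2 : (w ⟨i, hi⟩ α : Ordinal.{u}) < h ⟨⟨j, hj⟩, β⟩ :=
        hh ⟨⟨j, hj⟩, β⟩ ⟨⟨i, hi⟩, α⟩ heq.symm hβ
      rw [e1] at hle
      exact ((l1.trans (Subtype.coe_lt_coe.2 h4)).trans l2).not_ge (Subtype.coe_le_coe.2 hle))
  rw [hc.orderCof_Iio_ord] at ha
  exact (hsmall a).not_ge ha

end Main

theorem theorem2p5
    (κ : Cardinal.{u}) (hκ : κ.IsSingular) (hκcof : ℵ₀ < κ.ord.cof)
    (k : Iio κ.ord.cof.ord → Cardinal.{u})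
    (hk_normal : Order.IsNormal k)
    (hk_lt : ∀ i, k i < κ) (hk_cofinal : ∀ μ < κ, ∃ i, μ < k i)
    (hk_zero : ∀ i : Iio κ.ord.cof.ord, (i : Ordinal.{u}) = 0 → κ.ord.cof < k i)
    (S : Set (Iio κ.ord.cof.ord))
    (h1 : ∃ τ : (i : Iio κ.ord.cof.ord) → Iio (i : Ordinal.{u}).cof.ord → Cardinal.{u},
      (∀ i ∈ S, ∀ α, (τ i α).IsRegular ∧ τ i α < k i) ∧
      (∀ i ∈ S, ∃ D : Ultrafilter (Iio (i : Ordinal.{u}).cof.ord),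
        ExtendsFrechet D ∧ (∀ᶠ α in (D : Filter _), κ.ord.cof < τ i α) ∧
        UltraproductCof (τ i) D (Order.succ (Order.succ (k i)))) ∧
      (∀ j : Iio κ.ord.cof.ord,
        #{c : Cardinal.{u} | c < k j ∧ ∃ i ∈ S, ∃ α, c = τ i α} <
          Cardinal.lift.{u + 1} κ.ord.cof))
    (h2 : ∀ i ∈ S, IsLimitPointOf S i →
      IsGreatest (pcf {c : Cardinal.{u} | ∃ j ∈ S, j < i ∧ c = Order.succ (Order.succ (k j))})
        (Order.succ (k i))) :
    ¬ IsStationary S := by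
  have hc : κ.ord.cof.IsRegular := isRegular_cof (Ordinal.one_lt_cof_iff.1 (one_lt_aleph0.trans hκcof))
  refine not_isStationary_of_pcf hc hκcof hk_normal (fun j => ?_) h1 h2
  exact (hk_zero ⟨0, hc.ord_pos⟩ rfl).trans_le (hk_normal.monotone (zero_le : (0 : Ordinal) ≤ j))
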